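/- For a finite simple graph $G$, let $F(G)$ denote the number of connected subgraphs of $G$ (subgraphs are not required to be induced, and a connected subgraph has at least one vertex). A pendant vertex is a vertex of degree one. For $n\ge 4$, let $U^l_{n,3}$ be the lollipop graph on $n$ vertices obtained from a triangle and a path on $n-2$ vertices by identifying one end vertex of the path with a vertex of the triangle. Theorem. Let $n\ge 4$. The graph $U^l_{n,3}$ is a connected graph on $n$ vertices with exactly one pendant vertex, and every connected graph $G$ on $n$ vertices with exactly one pendant vertex satisfies $$F(G)\ \ge\ F(U^l_{n,3}),$$ with equality if and only if $G$ is isomorphic to $U^l_{n,3}$. -/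

import Mathlib

namespace CoreIndex

/-- The core index `F(G)`: the number of connected subgraphs of `G`. A subgraph is a set of
vertices together with a set of edges of `G` between them (not necessarily induced); a connected
subgraph has at least one vertex. -/
noncomputable def coreIndex {V : Type*} (G : SimpleGraph V) : ℕ :=
  {H : G.Subgraph | H.Connected}.ncard

/-- The pendant vertices of `G`: the vertices of degree one. -/
def pendantVertices {V : Type*} (G : SimpleGraph V) : Set V :=
  {v | (G.neighborSet v).ncard = 1}

/-- `G` is a connected (finite) graph on `n` vertices with exactly `k` pendant vertices. -/
structure MemPendantClass {V : Type*} (G : SimpleGraph V) (n k : ℕ) : Prop where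
  finite : Finite V
  card_eq : Nat.card V = n
  connected : G.Connected
  pendant : (pendantVertices G).ncard = k

/-- The lollipop on `n` vertices with girth `g` (for `3 ≤ g < n`): the vertices `0, …, g - 1` form
a cycle in this order, and the path `g - 1, g, …, n - 1` is attached to the cycle at its end
`g - 1`. -/
def lollipop (n g : ℕ) : SimpleGraph (Fin n) :=
  SimpleGraph.fromRel fun i j => i.val + 1 = j.val ∨ (i.val = 0 ∧ j.val + 1 = g)

end CoreIndex

namespace CoreIndex

open SimpleGraph

variable {V : Type*} {G : SimpleGraph V}

/-! Let `v` be the pendant vertex of `G`. A tree on at least two vertices has two leaves, so `G`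
contains a cycle; the cycle avoids `v`, so the connected graph `G - v` contains it too. The
connected subgraphs of `G` either avoid `v` or pass through it, and each kind is bounded below by
building the graph up from the cycle, one edge at a time (`grow`, `CyclicBounds.sup_edge`).

For a connected graph with a cycle on `m` vertices, at least `(m ^ 2 + 9 * m - 18) / 2` subgraphs
are connected, and at least `m + 6` of them pass through any given vertex, unless the graph is a
lollipop whose tail ends there. Hence a `G` that is not the lollipop has `F(G) ≥ (n ^ 2 + 9 * n -
14) / 2`, while `coreIndex_lollipop_three_le` gives at most `(n ^ 2 + 9 * n - 16) / 2` for the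
lollipop. The strict gap settles the equality case, and no exact count is needed. -/

/-- A connected subgraph meeting both `S` and its complement has an edge leaving `S`. -/
theorem exists_adj_leaving {H : G.Subgraph} (hH : H.Connected) {S : Set V} {x y : V}
    (hx : x ∈ H.verts) (hxS : x ∈ S) (hy : y ∈ H.verts) (hyS : y ∉ S) :
    ∃ a b, a ∈ S ∧ b ∉ S ∧ H.Adj a b := by
  obtain ⟨w⟩ := hH.preconnected ⟨x, hx⟩ ⟨y, hy⟩
  obtain ⟨d, -, h1, h2⟩ := w.exists_boundary_dart {z | z.1 ∈ S} hxS hyS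
  exact ⟨d.fst.1, d.snd.1, h1, h2, d.adj⟩

/-! ### Counting connected subgraphs when an edge is added -/

/-- The number of connected subgraphs contained in `K`. -/
noncomputable def connCount (K : G.Subgraph) : ℕ :=
  {H : G.Subgraph | H ≤ K ∧ H.Connected}.ncard

/-- The number of connected subgraphs contained in `K` and passing through `v`. -/
noncomputable def connCountAt (K : G.Subgraph) (v : V) : ℕ :=
  {H : G.Subgraph | H ≤ K ∧ H.Connected ∧ v ∈ H.verts}.ncard

theorem coreIndex_eq_connCount_top : coreIndex G = connCount (⊤ : G.Subgraph) := by
  simp [coreIndex, connCount]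

theorem connCount_mono [Finite V] {K K' : G.Subgraph} (h : K ≤ K') : connCount K ≤ connCount K' :=
  Set.ncard_le_ncard (fun _ hH => ⟨hH.1.trans h, hH.2⟩) (Set.toFinite _)

theorem connCount_add_connCountAt_le [Finite V] {K K' : G.Subgraph} (h : K ≤ K') {v : V}
    (hv : v ∉ K.verts) : connCount K + connCountAt K' v ≤ connCount K' := by
  unfold connCount connCountAt
  rw [← Set.ncard_union_eq _ (Set.toFinite _) (Set.toFinite _)]
  · refine Set.ncard_le_ncard ?_ (Set.toFinite _)
    rintro H (hH | hH)
    · exact ⟨hH.1.trans h, hH.2⟩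
    · exact ⟨hH.1, hH.2.1⟩
  · rw [Set.disjoint_left]
    intro H hH hH'
    exact hv (hH.1.1 hH'.2.2)

theorem connected_sup_edge {H : G.Subgraph} (hH : H.Connected) {x y : V} (h : G.Adj x y)
    (hx : x ∈ H.verts) : (H ⊔ G.subgraphOfAdj h).Connected :=
  Subgraph.connected_sup hH.preconnected (Subgraph.subgraphOfAdj_connected h).preconnected
    ⟨x, hx, by simp⟩

/-- Subgraphs form a distributive lattice, so `H` is recovered from `H ⊔ E` by intersecting with
`K`. The next two lemmas supply the hypothesis on `E ⊓ K` when `E` is an added edge. -/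
theorem sup_edge_inj {K E H H' : G.Subgraph} (hH : H ≤ K) (hH' : H' ≤ K) (hE : E ⊓ K ≤ H)
    (hE' : E ⊓ K ≤ H') (heq : H ⊔ E = H' ⊔ E) : H = H' := by
  have h1 : (H ⊔ E) ⊓ K = H := by
    rw [inf_sup_right, inf_eq_left.mpr hH, sup_eq_left.mpr hE]
  have h2 : (H' ⊔ E) ⊓ K = H' := by
    rw [inf_sup_right, inf_eq_left.mpr hH', sup_eq_left.mpr hE']
  rw [← h1, ← h2, heq]

theorem edge_inf_le_of_verts_eq {K H : G.Subgraph} {x y : V} (h : G.Adj x y)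
    (hxy : ¬ K.Adj x y) (hv : H.verts = K.verts) : G.subgraphOfAdj h ⊓ K ≤ H := by
  refine ⟨fun z hz => hv ▸ hz.2, fun a b hab => ?_⟩
  obtain ⟨h1, h2⟩ := hab
  rw [subgraphOfAdj_adj, Sym2.eq_iff] at h1
  rcases h1 with ⟨rfl, rfl⟩ | ⟨rfl, rfl⟩
  · exact absurd h2 hxy
  · exact absurd h2.symm hxy

theorem edge_inf_le_of_notMem {K H : G.Subgraph} {x y : V} (h : G.Adj x y)
    (hy : y ∉ K.verts) (hx : x ∈ H.verts) : G.subgraphOfAdj h ⊓ K ≤ H := by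
  refine ⟨fun z hz => ?_, fun a b hab => ?_⟩
  · obtain ⟨h1, h2⟩ := hz
    rcases h1 with rfl | rfl
    · exact hx
    · exact absurd h2 hy
  · obtain ⟨h1, h2⟩ := hab
    rw [subgraphOfAdj_adj, Sym2.eq_iff] at h1
    rcases h1 with ⟨rfl, rfl⟩ | ⟨rfl, rfl⟩
    · exact absurd h2.snd_mem hy
    · exact absurd h2.fst_mem hy

/-- Hanging a new vertex `u` on `x` gives, through `u`, the old subgraphs through `x` extended
by the new edge, and the single vertex `u`. -/
theorem connCountAt_add_one_le_pendant [Finite V] {K : G.Subgraph} {x u : V} (h : G.Adj x u)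
    (hu : u ∉ K.verts) :
    connCountAt K x + 1 ≤ connCountAt (K ⊔ G.subgraphOfAdj h) u := by
  unfold connCountAt
  have hinj : Set.InjOn (fun H : G.Subgraph => H ⊔ G.subgraphOfAdj h)
      {H : G.Subgraph | H ≤ K ∧ H.Connected ∧ x ∈ H.verts} := by
    rintro H ⟨hH, -, hx⟩ H' ⟨hH', -, hx'⟩ heq
    exact sup_edge_inj hH hH' (edge_inf_le_of_notMem h hu hx)
      (edge_inf_le_of_notMem h hu hx') heq
  rw [← hinj.ncard_image, ← Set.ncard_insert_of_notMem (a := G.singletonSubgraph u)]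
  · refine Set.ncard_le_ncard ?_ (Set.toFinite _)
    rintro H (rfl | ⟨H, ⟨hH, hc, hx⟩, rfl⟩)
    · refine ⟨?_, Subgraph.singletonSubgraph_connected, by simp⟩
      rw [singletonSubgraph_le_iff]
      simp
    · exact ⟨sup_le_sup_right hH _, connected_sup_edge hc h hx, by simp⟩
  · rintro ⟨H, -, heq⟩
    have : x ∈ (G.singletonSubgraph u).verts := by
      rw [← heq]; simp
    rw [singletonSubgraph_verts] at this
    exact h.ne this

/-! ### Spanning connected subgraphs and edge-by-edge growth -/

/-- `K` is connected and stays so after deleting edges in at least two ways. -/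
def HasTwoSpanning (K : G.Subgraph) : Prop :=
  K.Connected ∧ ∃ A B : G.Subgraph, (A.Connected ∧ A ≤ K ∧ A.verts = K.verts) ∧
    (B.Connected ∧ B ≤ K ∧ B.verts = K.verts) ∧ A ≠ K ∧ B ≠ K ∧ A ≠ B

theorem HasTwoSpanning.sup_edge {K : G.Subgraph} (hK : HasTwoSpanning K) {x y : V}
    (h : G.Adj x y) (hx : x ∈ K.verts) (hxy : ¬ K.Adj x y) :
    HasTwoSpanning (K ⊔ G.subgraphOfAdj h) := by
  obtain ⟨hc, A, B, ⟨hA, hAK, hAv⟩, ⟨hB, hBK, hBv⟩, h1, h2, h3⟩ := hK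
  have key : ∀ {D D' : G.Subgraph}, D ≤ K → D' ≤ K → D.verts = K.verts → D'.verts = K.verts →
      D ≠ D' → D ⊔ G.subgraphOfAdj h ≠ D' ⊔ G.subgraphOfAdj h := fun hD hD' hv hv' hne heq =>
    hne (sup_edge_inj hD hD' (edge_inf_le_of_verts_eq h hxy hv)
      (edge_inf_le_of_verts_eq h hxy hv') heq)
  refine ⟨connected_sup_edge hc h hx, A ⊔ G.subgraphOfAdj h, B ⊔ G.subgraphOfAdj h,
    ⟨connected_sup_edge hA h (hAv ▸ hx), sup_le_sup_right hAK _, ?_⟩,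
    ⟨connected_sup_edge hB h (hBv ▸ hx), sup_le_sup_right hBK _, ?_⟩,
    key hAK le_rfl hAv rfl h1, key hBK le_rfl hBv rfl h2, key hAK hBK hAv hBv h3⟩
  · rw [Subgraph.verts_sup, Subgraph.verts_sup, hAv]
  · rw [Subgraph.verts_sup, Subgraph.verts_sup, hBv]

/-- Adding the edge to `K`, `A` and `B` gives three connected subgraphs through every vertex of `K`;
they are new because they use the edge. -/
theorem HasTwoSpanning.connCountAt_add_three_le [Finite V] {K : G.Subgraph} (hK : HasTwoSpanning K)
    {x y v : V} (h : G.Adj x y) (hx : x ∈ K.verts) (hxy : ¬ K.Adj x y) (hv : v ∈ K.verts) :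
    connCountAt K v + 3 ≤ connCountAt (K ⊔ G.subgraphOfAdj h) v := by
  have hc := (hK.sup_edge h hx hxy).1
  obtain ⟨-, A, B, ⟨hA, hAK, hAv⟩, ⟨hB, hBK, hBv⟩, h1, h2, h3⟩ := hK
  set e := G.subgraphOfAdj h with he
  have key : ∀ {D D' : G.Subgraph}, D ≤ K → D' ≤ K → D.verts = K.verts → D'.verts = K.verts →
      D ≠ D' → D ⊔ e ≠ D' ⊔ e := fun hD hD' hv hv' hne heq =>
    hne (sup_edge_inj hD hD' (edge_inf_le_of_verts_eq h hxy hv)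
      (edge_inf_le_of_verts_eq h hxy hv') heq)
  have h3' : ({K ⊔ e, A ⊔ e, B ⊔ e} : Set G.Subgraph).ncard = 3 := by
    rw [Set.ncard_eq_three]
    exact ⟨_, _, _, (key hAK le_rfl hAv rfl h1).symm, (key hBK le_rfl hBv rfl h2).symm,
      key hAK hBK hAv hBv h3, rfl⟩
  unfold connCountAt
  rw [← h3', ← Set.ncard_union_eq _ (Set.toFinite _) (Set.toFinite _)]
  · refine Set.ncard_le_ncard ?_ (Set.toFinite _)
    rintro H (⟨hH, hHc, hHv⟩ | rfl | rfl | rfl)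
    · exact ⟨hH.trans le_sup_left, hHc, hHv⟩
    · exact ⟨le_rfl, hc, Or.inl hv⟩
    · exact ⟨sup_le_sup_right hAK _, connected_sup_edge hA h (hAv ▸ hx), Or.inl (hAv ▸ hv)⟩
    · exact ⟨sup_le_sup_right hBK _, connected_sup_edge hB h (hBv ▸ hx), Or.inl (hBv ▸ hv)⟩
  · rw [Set.disjoint_left]
    have hne : ∀ D : G.Subgraph, ¬ D ⊔ e ≤ K := fun D hD =>
      hxy ((le_sup_right.trans hD).2 (by simp [he]))
    rintro H ⟨hH, -⟩ (rfl | rfl | rfl) <;> exact hne _ hH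

/-- A property of subgraphs that survives attaching edges passes from a subgraph to any connected
subgraph above it. -/
theorem grow [Finite V] {p : G.Subgraph → Prop}
    (hstep : ∀ D, p D → ∀ x y (h : G.Adj x y), x ∈ D.verts → ¬ D.Adj x y →
      p (D ⊔ G.subgraphOfAdj h))
    {C K : G.Subgraph} (hCK : C ≤ K) (hC : C.verts.Nonempty) (hK : K.Connected) (hp : p C) :
    p K := by
  obtain ⟨D, hCD, hD⟩ := Set.Finite.exists_le_maximal
    (Set.toFinite {D : G.Subgraph | D ≤ K ∧ p D}) (a := C) ⟨hCK, hp⟩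
  suffices h : K ≤ D by
    rw [le_antisymm h hD.prop.1]
    exact hD.prop.2
  -- An edge of `K` at a vertex of `D` but missing from `D` could be attached, against maximality.
  have hadj : ∀ x y, x ∈ D.verts → K.Adj x y → D.Adj x y := by
    intro x y hx hxy
    by_contra hn
    have h := hxy.adj_sub
    have hle : G.subgraphOfAdj h ≤ K := by
      rw [subgraphOfAdj_le_iff]
      exact hxy
    have := hD.le_of_ge ⟨sup_le hD.prop.1 hle, hstep D hD.prop.2 x y h hx hn⟩ le_sup_left
    exact hn (this.2 (Or.inr (by simp)))
  have hverts : K.verts ⊆ D.verts := by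
    intro y hy
    by_contra hn
    obtain ⟨x, hx⟩ := hC
    obtain ⟨a, b, ha, hb, hab⟩ := exists_adj_leaving hK (hCK.1 hx) (hCD.1 hx) hy hn
    exact hb (hadj a b ha hab).snd_mem
  exact ⟨hverts, fun x y hxy => hadj x y (hverts hxy.fst_mem) hxy⟩

/-! ### Lollipops as subgraphs -/

/-- The adjacency of the lollipop with girth three on the natural numbers. -/
def LollipopRel (i j : ℕ) : Prop :=
  (i + 1 = j ∨ i = 0 ∧ j = 2) ∨ (j + 1 = i ∨ j = 0 ∧ i = 2)

/-- `H` is a lollipop on `n` vertices with girth three whose tail ends in `v` (if `n = 3`, a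
triangle containing `v`). -/
def IsLollipop (H : G.Subgraph) (n : ℕ) (v : V) : Prop :=
  3 ≤ n ∧ ∃ p : ℕ → V, Set.InjOn p (Set.Iio n) ∧ H.verts = p '' Set.Iio n ∧ v = p (n - 1) ∧
    ∀ i < n, ∀ j < n, H.Adj (p i) (p j) ↔ LollipopRel i j

theorem IsLollipop.extend {H : G.Subgraph} {n : ℕ} {v u : V} (hH : IsLollipop H n v)
    (h : G.Adj v u) (hu : u ∉ H.verts) : IsLollipop (H ⊔ G.subgraphOfAdj h) (n + 1) u := by
  obtain ⟨hn, p, hinj, hverts, hv, hadj⟩ := hH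
  have hpu : ∀ i < n, p i ≠ u := fun i hi he => hu (hverts ▸ ⟨i, hi, he⟩)
  -- The new vertex takes label `n`, so its only neighbour is the old tail end `p (n - 1)`.
  refine ⟨by omega, fun i => if i < n then p i else u, ?_, ?_, by simp, ?_⟩
  · intro i hi j hj hij
    simp only [Set.mem_Iio] at hi hj
    dsimp only at hij
    split_ifs at hij with h1 h2 h2
    · exact hinj h1 h2 hij
    · exact absurd hij (hpu i h1)
    · exact absurd hij.symm (hpu j h2)
    · omega
  · ext z
    simp only [Subgraph.verts_sup, subgraphOfAdj_verts, Set.mem_union, hverts, Set.mem_image,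
      Set.mem_Iio, Set.mem_insert_iff, Set.mem_singleton_iff]
    constructor
    · rintro (⟨i, hi, rfl⟩ | rfl | rfl)
      · exact ⟨i, by omega, by simp [hi]⟩
      · exact ⟨n - 1, by omega, by rw [if_pos (by omega), hv]⟩
      · exact ⟨n, by omega, by simp⟩
    · rintro ⟨i, hi, rfl⟩
      split_ifs with h1
      · exact Or.inl ⟨i, h1, rfl⟩
      · exact Or.inr (Or.inr rfl)
  · intro i hi j hj
    have hpv : ∀ i < n, (p i = v ↔ i = n - 1) := by
      intro i hi
      rw [hv]
      exact ⟨fun e => hinj hi (Set.mem_Iio.2 (by omega)) e, fun e => by rw [e]⟩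
    simp only [Subgraph.sup_adj, subgraphOfAdj_adj, Sym2.eq_iff]
    split_ifs with h1 h2 h2
    · have e1 := hpu i h1
      have e2 := hpu j h2
      rw [hadj i h1 j h2]
      refine or_iff_left ?_
      rintro (⟨-, e⟩ | ⟨-, e⟩)
      · exact e2 e.symm
      · exact e1 e.symm
    · have e1 : ¬ H.Adj (p i) u := fun e => hu e.snd_mem
      have e2 := hpv i h1
      have e3 := hpu i h1
      have e4 := h.ne
      unfold LollipopRel
      constructor
      · rintro (e | ⟨e, -⟩ | ⟨e, -⟩)
        · exact absurd e e1
        · have := e2.1 e.symm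
          omega
        · exact absurd e e4
      · intro e
        right; left
        exact ⟨(e2.2 (by omega)).symm, rfl⟩
    · have e1 : ¬ H.Adj u (p j) := fun e => hu e.fst_mem
      have e2 := hpv j h2
      have e3 := hpu j h2
      have e4 := h.ne
      unfold LollipopRel
      constructor
      · rintro (e | ⟨e, -⟩ | ⟨e, -⟩)
        · exact absurd e e1
        · exact absurd e e4
        · have := e2.1 e.symm
          omega
      · intro e
        right; right
        exact ⟨(e2.2 (by omega)).symm, rfl⟩
    · have e4 := h.ne
      unfold LollipopRel
      constructor
      · rintro (e | ⟨e, -⟩ | ⟨e, -⟩)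
        · exact absurd rfl e.ne
        · exact absurd e e4
        · exact absurd e e4
      · intro e
        omega

/-! ### Lower bounds for graphs with a cycle -/

/-- The lower bounds on the numbers of connected subgraphs that hold in every connected graph
containing a cycle. -/
structure CyclicBounds (K : G.Subgraph) : Prop where
  two_spanning : HasTwoSpanning K
  add_four_le : ∀ v ∈ K.verts, K.verts.ncard + 4 ≤ connCountAt K v
  add_six_le : ∀ v ∈ K.verts,
    K.verts.ncard + 6 ≤ connCountAt K v ∨ IsLollipop K K.verts.ncard v
  quadratic_le : K.verts.ncard ^ 2 + 9 * K.verts.ncard ≤ 2 * connCount K + 18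

/-- Every old vertex gains three subgraphs while the order grows by at most one, so `+ 4` becomes at
least `+ 6` there. Only a new vertex `y` gains as little as one; it can miss `+ 6` only if `x` did,
and then the lollipop ending at `x` extends to one ending at `y`. -/
theorem CyclicBounds.sup_edge [Finite V] {K : G.Subgraph} (hK : CyclicBounds K) {x y : V}
    (h : G.Adj x y) (hx : x ∈ K.verts) (hxy : ¬ K.Adj x y) :
    CyclicBounds (K ⊔ G.subgraphOfAdj h) := by
  have h3 := fun v hv => hK.two_spanning.connCountAt_add_three_le (v := v) h hx hxy hv
  by_cases hy : y ∈ K.verts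
  · have hverts : (K ⊔ G.subgraphOfAdj h).verts = K.verts := by
      rw [Subgraph.verts_sup, subgraphOfAdj_verts, Set.union_eq_left]
      rintro z (rfl | rfl) <;> assumption
    have hmono : connCount K ≤ connCount (K ⊔ G.subgraphOfAdj h) := connCount_mono le_sup_left
    refine ⟨hK.two_spanning.sup_edge h hx hxy, ?_, ?_, ?_⟩ <;> rw [hverts]
    · intro v hv
      have := h3 v hv
      have := hK.add_four_le v hv
      omega
    · intro v hv
      have := h3 v hv
      have := hK.add_four_le v hv
      left
      omega
    · have := hK.quadratic_le
      omega
  · have hverts : (K ⊔ G.subgraphOfAdj h).verts = insert y K.verts := by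
      ext z
      simp only [Subgraph.verts_sup, subgraphOfAdj_verts, Set.mem_union, Set.mem_insert_iff,
        Set.mem_singleton_iff]
      constructor
      · rintro (hz | rfl | rfl) <;> tauto
      · tauto
    have hcard : (K ⊔ G.subgraphOfAdj h).verts.ncard = K.verts.ncard + 1 := by
      rw [hverts, Set.ncard_insert_of_notMem hy (Set.toFinite _)]
    have hnew := connCountAt_add_one_le_pendant (K := K) h hy
    have htot : connCount K + connCountAt _ y ≤ connCount (K ⊔ G.subgraphOfAdj h) :=
      connCount_add_connCountAt_le le_sup_left hy
    have hx4 := hK.add_four_le x hx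
    refine ⟨hK.two_spanning.sup_edge h hx hxy, ?_, ?_, ?_⟩ <;> rw [hcard]
    · rw [hverts]
      rintro v (rfl | hv)
      · omega
      · have := h3 v hv
        have := hK.add_four_le v hv
        omega
    · rw [hverts]
      rintro v (rfl | hv)
      · rcases hK.add_six_le x hx with h6 | hl
        · left
          omega
        · exact Or.inr (hl.extend h hy)
      · have := h3 v hv
        have := hK.add_four_le v hv
        left
        omega
    -- With `m = K.verts.ncard`, half the quadratic grows by exactly `m + 5`, the guaranteed number
    -- of subgraphs through `y`.
    · have := hK.quadratic_le
      nlinarith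

/-! ### Arcs of a cycle -/

section Cycle

variable {k : ℕ} {c : ZMod k → V}

theorem zmod_val_add_one_le (x : ZMod k) : (x + 1).val ≤ x.val + 1 := by
  have h1 := ZMod.val_add_le x 1
  have h2 : (1 : ZMod k).val ≤ 1 := by
    rw [ZMod.val_one_eq_one_mod]
    exact Nat.mod_le 1 k
  omega

theorem zmod_val_sub_one [NeZero k] (hk : 2 ≤ k) {x : ZMod k} (hx : x ≠ 0) :
    (x - 1).val + 1 = x.val := by
  have h1 : (1 : ZMod k).val = 1 := by
    rw [ZMod.val_one_eq_one_mod, Nat.mod_eq_of_lt hk]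
  have h2 : x.val ≠ 0 := by rwa [Ne, ZMod.val_eq_zero]
  rw [ZMod.val_sub (by omega), h1]
  omega

theorem zmod_val_neg_one [NeZero k] : (-1 : ZMod k).val + 1 = k := by
  obtain ⟨m, rfl⟩ := Nat.exists_eq_succ_of_ne_zero (NeZero.ne k)
  rw [ZMod.val_neg_one]

/-- The arc with `j` edges of the closed walk `c`, from `c i` onwards. -/
def arc (hc : ∀ i, G.Adj (c i) (c (i + 1))) (i : ZMod k) (j : ℕ) : G.Subgraph where
  verts := c '' {m | (m - i).val ≤ j}
  Adj x y := ∃ m, (m - i).val < j ∧ s(x, y) = s(c m, c (m + 1))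
  adj_sub := by
    rintro x y ⟨m, -, h⟩
    rw [← mem_edgeSet, h]
    exact hc m
  edge_vert := by
    rintro x y ⟨m, hm, h⟩
    rw [Sym2.eq_iff] at h
    rcases h with ⟨rfl, -⟩ | ⟨rfl, -⟩
    · exact ⟨m, hm.le, rfl⟩
    · refine ⟨m + 1, ?_, rfl⟩
      have := zmod_val_add_one_le (m - i)
      rw [Set.mem_ofPred_eq, add_sub_right_comm]
      omega
  symm := ⟨by
    rintro x y ⟨m, hm, h⟩
    exact ⟨m, hm, Sym2.eq_swap.trans h⟩⟩

variable (hc : ∀ i, G.Adj (c i) (c (i + 1)))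

theorem arc_verts_eq_range [NeZero k] (i : ZMod k) {j : ℕ} (hj : k ≤ j + 1) :
    (arc hc i j).verts = Set.range c := by
  ext x
  constructor
  · rintro ⟨m, -, rfl⟩
    exact ⟨m, rfl⟩
  · rintro ⟨m, rfl⟩
    have := ZMod.val_lt (m - i)
    exact ⟨m, by rw [Set.mem_ofPred_eq]; omega, rfl⟩

theorem arc_le_full [NeZero k] (i i' : ZMod k) (j : ℕ) : arc hc i j ≤ arc hc i' k := by
  refine ⟨?_, fun x y => ?_⟩
  · rw [arc_verts_eq_range hc i' (by omega)]
    rintro _ ⟨m, -, rfl⟩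
    exact ⟨m, rfl⟩
  · rintro ⟨m, -, e⟩
    exact ⟨m, ZMod.val_lt _, e⟩

theorem mem_arc_iff (hinj : Function.Injective c) {i m : ZMod k} {j : ℕ} :
    c m ∈ (arc hc i j).verts ↔ (m - i).val ≤ j := by
  constructor
  · rintro ⟨m', hm', e⟩
    rw [← hinj e]
    exact hm'
  · exact fun h => ⟨m, h, rfl⟩

/-- With `k ≥ 3` the edges `c m, c (m + 1)` are distinct for distinct `m`: a reversed coincidence
would force `2 = 0` in `ZMod k`. -/
theorem arc_adj_iff (hk : 3 ≤ k) (hinj : Function.Injective c) {i m : ZMod k} {j : ℕ} :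
    (arc hc i j).Adj (c m) (c (m + 1)) ↔ (m - i).val < j := by
  constructor
  · rintro ⟨m', hm', e⟩
    rw [Sym2.eq_iff] at e
    rcases e with ⟨e, -⟩ | ⟨e, e'⟩
    · rwa [hinj e]
    · have h1 := hinj e
      have h2 := hinj e'
      have h3 : ((2 : ℕ) : ZMod k) = 0 := by
        push_cast
        linear_combination h2 - h1
      rw [ZMod.natCast_eq_zero_iff] at h3
      exact absurd (Nat.le_of_dvd (by norm_num) h3) (by omega)
  · exact fun h => ⟨m, h, rfl⟩

theorem arc_connected [NeZero k] (hk : 2 ≤ k) (i : ZMod k) (j : ℕ) :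
    (arc hc i j).Connected := by
  have h0 : c i ∈ (arc hc i j).verts := ⟨i, by simp, rfl⟩
  have key : ∀ t : ℕ, ∀ m : ZMod k, (m - i).val = t → ∀ hm : c m ∈ (arc hc i j).verts,
      t ≤ j → (arc hc i j).coe.Reachable ⟨c i, h0⟩ ⟨c m, hm⟩ := by
    intro t
    induction t with
    | zero =>
      intro m hm hm' _
      rw [ZMod.val_eq_zero, sub_eq_zero] at hm
      subst hm
      rfl
    | succ t ih =>
      intro m hm hm' ht
      have hne : m - i ≠ 0 := by
        rw [Ne, ← ZMod.val_eq_zero]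
        omega
      have h1 := zmod_val_sub_one hk hne
      rw [sub_right_comm] at h1
      have h2 : (arc hc i j).Adj (c (m - 1)) (c m) := ⟨m - 1, by omega, by rw [sub_add_cancel]⟩
      exact (ih (m - 1) (by omega) h2.fst_mem (by omega)).trans (Adj.reachable h2)
  rw [Subgraph.connected_iff']
  refine Connected.mk (fun x y => ?_) (nonempty := ⟨⟨c i, h0⟩⟩)
  have : ∀ z : (arc hc i j).verts, (arc hc i j).coe.Reachable ⟨c i, h0⟩ z := by
    rintro ⟨_, m, hm, rfl⟩
    exact key _ m rfl _ hm
  exact (this x).symm.trans (this y)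

/-- The start of an arc with fewer than `k` edges is its only vertex whose preceding cycle edge is
absent from the arc. -/
theorem arc_injective [NeZero k] (hk : 3 ≤ k) (hinj : Function.Injective c) {i i' : ZMod k}
    {j j' : ℕ} (hj : j < k) (hj' : j' < k) (h : arc hc i j = arc hc i' j') :
    i = i' ∧ j = j' := by
  have hv : ∀ m, (m - i).val ≤ j ↔ (m - i').val ≤ j' := fun m => by
    rw [← mem_arc_iff hc hinj, ← mem_arc_iff hc hinj, h]
  have he : ∀ m, (m - i).val < j ↔ (m - i').val < j' := fun m => by
    rw [← arc_adj_iff hc hk hinj, ← arc_adj_iff hc hk hinj, h]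
  have hi : i = i' := by
    by_contra hne
    have h1 : (i - i').val ≤ j' := (hv i).1 (by simp)
    have h2 := zmod_val_sub_one (by omega) (sub_ne_zero.2 hne)
    rw [sub_right_comm] at h2
    have h3 := (he (i - 1)).2 (by omega)
    rw [sub_sub_cancel_left] at h3
    have := zmod_val_neg_one (k := k)
    omega
  subst hi
  refine ⟨rfl, ?_⟩
  have h1 := (hv (i + j)).1
  have h2 := (hv (i + j')).2
  rw [add_sub_cancel_left, ZMod.val_cast_of_lt hj] at h1
  rw [add_sub_cancel_left, ZMod.val_cast_of_lt hj'] at h2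
  have h1 := h1 le_rfl
  have h2 := h2 le_rfl
  omega

theorem arc_ne_full [NeZero k] (hk : 3 ≤ k) (hinj : Function.Injective c) {i i' : ZMod k}
    {j : ℕ} (hj : j < k) : arc hc i j ≠ arc hc i' k := by
  intro h
  have h1 := arc_adj_iff hc hk hinj (i := i) (m := i - 1) (j := j)
  rw [h, arc_adj_iff hc hk hinj, sub_sub_cancel_left] at h1
  have h2 := h1.1 (ZMod.val_lt _)
  have := zmod_val_neg_one (k := k)
  omega

/-- Deleting either of two different edges leaves a spanning path. -/
theorem hasTwoSpanning_cycle [NeZero k] (hk : 3 ≤ k) (hinj : Function.Injective c) :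
    HasTwoSpanning (arc hc 0 k) := by
  have hv : ∀ i, (arc hc i (k - 1)).verts = (arc hc 0 k).verts := fun i => by
    rw [arc_verts_eq_range hc _ (by omega), arc_verts_eq_range hc _ (by omega)]
  refine ⟨arc_connected hc (by omega) _ _, arc hc 0 (k - 1), arc hc 1 (k - 1),
    ⟨arc_connected hc (by omega) _ _, arc_le_full hc _ _ _, hv _⟩,
    ⟨arc_connected hc (by omega) _ _, arc_le_full hc _ _ _, hv _⟩,
    arc_ne_full hc hk hinj (by omega), arc_ne_full hc hk hinj (by omega), fun h => ?_⟩
  have := (arc_injective hc hk hinj (by omega) (by omega) h).1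
  have h1 : ((1 : ℕ) : ZMod k) = 0 := by
    push_cast
    exact this.symm
  rw [ZMod.natCast_eq_zero_iff] at h1
  exact absurd (Nat.le_of_dvd (by norm_num) h1) (by omega)

/-- There are `k` starts and `k` lengths for a proper arc, and the whole cycle is one more. -/
theorem sq_add_one_le_connCount_cycle [Finite V] [NeZero k] (hk : 3 ≤ k)
    (hinj : Function.Injective c) : k ^ 2 + 1 ≤ connCount (arc hc 0 k) := by
  classical
  set T : Finset (ZMod k × ℕ) := Finset.univ ×ˢ Finset.range k with hT
  have himg : (T.image fun q => arc hc q.1 q.2).card = k ^ 2 := by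
    rw [Finset.card_image_of_injOn, hT, Finset.card_product, Finset.card_univ, ZMod.card,
      Finset.card_range, sq]
    rintro ⟨i, j⟩ h ⟨i', j'⟩ h' e
    simp only [hT, Finset.coe_product, Set.mem_prod, Finset.mem_coe, Finset.mem_range] at h h'
    obtain ⟨rfl, rfl⟩ := arc_injective hc hk hinj h.2 h'.2 e
    rfl
  rw [← himg, ← Finset.card_insert_of_notMem (a := arc hc 0 k), ← Set.ncard_coe_finset]
  · refine Set.ncard_le_ncard ?_ (Set.toFinite _)
    intro H hH
    rw [Finset.mem_coe, Finset.mem_insert, Finset.mem_image] at hH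
    rcases hH with rfl | ⟨q, -, rfl⟩
    · exact ⟨le_rfl, arc_connected hc (by omega) _ _⟩
    · exact ⟨arc_le_full hc _ _ _, arc_connected hc (by omega) _ _⟩
  · intro h
    obtain ⟨q, hq, e⟩ := Finset.mem_image.1 h
    simp only [hT, Finset.mem_product, Finset.mem_range] at hq
    exact arc_ne_full hc hk hinj hq.2 e

/-- An arc with `j < k` edges through `c m` starts at `m - s` with `0 ≤ s ≤ j`. Summing `j + 1` over
`j` and adding the whole cycle gives the bound. -/
theorem le_connCountAt_cycle [Finite V] [NeZero k] (hk : 3 ≤ k)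
    (hinj : Function.Injective c) (m : ZMod k) :
    k * (k + 1) + 2 ≤ 2 * connCountAt (arc hc 0 k) (c m) := by
  classical
  set T : Finset (Σ _ : ℕ, ℕ) := (Finset.range k).sigma fun j => Finset.range (j + 1) with hT
  have hcard : T.card * 2 = k * (k + 1) := by
    rw [hT, Finset.card_sigma]
    simp only [Finset.card_range]
    have := Finset.sum_range_id_mul_two (k + 1)
    rw [Finset.sum_range_succ'] at this
    simp only [add_zero, Nat.add_sub_cancel] at this
    rw [this, mul_comm]
  have himg : (T.image fun q => arc hc (m - q.2) q.1).card = T.card := by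
    apply Finset.card_image_of_injOn
    rintro ⟨j, s⟩ h ⟨j', s'⟩ h' e
    simp only [hT, Finset.coe_sigma, Set.mem_sigma_iff, Finset.mem_coe, Finset.mem_range] at h h'
    obtain ⟨h1, rfl⟩ := arc_injective hc hk hinj h.1 h'.1 e
    have h2 := congrArg ZMod.val (sub_right_injective h1)
    dsimp only at h2
    rw [ZMod.val_cast_of_lt (by omega), ZMod.val_cast_of_lt (by omega)] at h2
    rw [h2]
  have hle : T.card + 1 ≤ connCountAt (arc hc 0 k) (c m) := by
    rw [← himg, ← Finset.card_insert_of_notMem (a := arc hc 0 k), ← Set.ncard_coe_finset]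
    · refine Set.ncard_le_ncard ?_ (Set.toFinite _)
      intro H hH
      rw [Finset.mem_coe, Finset.mem_insert, Finset.mem_image] at hH
      rcases hH with rfl | ⟨q, hq, rfl⟩
      · refine ⟨le_rfl, arc_connected hc (by omega) _ _, ?_⟩
        rw [arc_verts_eq_range hc _ (by omega)]
        exact ⟨m, rfl⟩
      · refine ⟨arc_le_full hc _ _ _, arc_connected hc (by omega) _ _, ?_⟩
        simp only [hT, Finset.mem_sigma, Finset.mem_range] at hq
        rw [mem_arc_iff hc hinj, sub_sub_cancel, ZMod.val_cast_of_lt (by omega)]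
        omega
    · intro h
      obtain ⟨q, hq, e⟩ := Finset.mem_image.1 h
      simp only [hT, Finset.mem_sigma, Finset.mem_range] at hq
      exact arc_ne_full hc hk hinj hq.1 e
  omega

theorem isLollipop_triangle {c : ZMod 3 → V} (hc : ∀ i, G.Adj (c i) (c (i + 1)))
    (hinj : Function.Injective c) (m : ZMod 3) : IsLollipop (arc hc 0 3) 3 (c m) := by
  -- The shift by `m + 1` puts `c m` at label `2`, the tail end when `n = 3`.
  refine ⟨le_rfl, fun i => c (m + 1 + i), ?_, ?_, ?_, ?_⟩
  · intro i hi j hj e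
    have := congrArg ZMod.val (add_left_cancel (hinj e))
    rwa [ZMod.val_cast_of_lt hi, ZMod.val_cast_of_lt hj] at this
  · rw [arc_verts_eq_range hc _ (by omega)]
    ext x
    constructor
    · rintro ⟨a, rfl⟩
      exact ⟨(a - (m + 1)).val, ZMod.val_lt _, by simp⟩
    · rintro ⟨i, -, rfl⟩
      exact ⟨_, rfl⟩
  · dsimp only
    congr 1
    revert m
    decide
  · have hadj : ∀ a b : ZMod 3, (arc hc 0 3).Adj (c a) (c b) ↔ a ≠ b := by
      intro a b
      constructor
      · rintro h rfl
        exact h.ne rfl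
      · intro h
        have h' : b = a + 1 ∨ a = b + 1 := by
          revert a b
          decide
        rcases h' with rfl | rfl
        · exact (arc_adj_iff hc le_rfl hinj).2 (ZMod.val_lt _)
        · exact ((arc_adj_iff hc le_rfl hinj).2 (ZMod.val_lt _)).symm
    intro i hi j hj
    have hij : (i : ZMod 3) = j ↔ i = j := by
      refine ⟨fun e => ?_, fun e => by rw [e]⟩
      have := congrArg ZMod.val e
      rwa [ZMod.val_cast_of_lt hi, ZMod.val_cast_of_lt hj] at this
    rw [hadj, Ne, add_right_inj, hij]
    unfold LollipopRel
    omega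

theorem cyclicBounds_cycle [Finite V] [NeZero k] (hk : 3 ≤ k) (hinj : Function.Injective c) :
    CyclicBounds (arc hc 0 k) := by
  have hverts := arc_verts_eq_range hc 0 (j := k) (by omega)
  have hcard : (arc hc 0 k).verts.ncard = k := by
    rw [hverts, ← Set.image_univ, Set.ncard_image_of_injective _ hinj, Set.ncard_univ,
      Nat.card_zmod]
  refine ⟨hasTwoSpanning_cycle hc hk hinj, ?_, ?_, ?_⟩ <;> rw [hcard]
  · rw [hverts]
    rintro _ ⟨m, rfl⟩
    have := le_connCountAt_cycle hc hk hinj m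
    nlinarith
  · rw [hverts]
    rintro _ ⟨m, rfl⟩
    -- For `k ≥ 4`, `k * (k + 1) / 2 + 1 ≥ k + 6`; the triangle gives only `7 = 3 + 4`.
    rcases hk.eq_or_lt with rfl | hk'
    · exact Or.inr (isLollipop_triangle hc hinj m)
    · have := le_connCountAt_cycle hc hk hinj m
      left
      nlinarith
  · have := sq_add_one_le_connCount_cycle hc hk hinj
    -- The difference of the two sides is `(k - 4) * (k - 5)`, nonnegative at integers. It vanishes
    -- for `k = 4, 5`, which is why the constant is 18.
    rcases Nat.lt_or_ge k 5 with h | h <;> nlinarith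

end Cycle

/-! ### Finding a cycle and applying the bounds -/

/-- A connected subgraph containing a cycle satisfies the bounds. -/
theorem cyclicBounds_of_cycle_le [Finite V] {k : ℕ} {c : ZMod k → V}
    (hc : ∀ i, G.Adj (c i) (c (i + 1))) (hk : 3 ≤ k) (hinj : Function.Injective c)
    {K : G.Subgraph} (hK : K.Connected) (hle : arc hc 0 k ≤ K) : CyclicBounds K := by
  have : NeZero k := ⟨by omega⟩
  refine grow (fun D hD x y h hx hxy => hD.sup_edge h hx hxy) hle ?_ hK
    (cyclicBounds_cycle hc hk hinj)
  exact (arc_connected hc (by omega) 0 k).nonempty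

/-- A finite connected graph on at least two vertices with at most one vertex of degree one
contains a cycle. -/
theorem exists_cycle [Finite V] [Nontrivial V] (hG : G.Connected)
    (hp : (pendantVertices G).ncard ≤ 1) :
    ∃ (k : ℕ) (c : ZMod k → V), 3 ≤ k ∧ Function.Injective c ∧ ∀ i, G.Adj (c i) (c (i + 1)) := by
  classical
  have hac : ¬ G.IsAcyclic := by
    intro h
    have := Fintype.ofFinite V
    obtain ⟨u, v, huv, hu, hv⟩ := (IsTree.mk hG h).exists_ne_and_degree_eq_one
    have hmem : ∀ w, G.degree w = 1 → w ∈ pendantVertices G := fun w hw => by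
      rw [pendantVertices, Set.mem_ofPred_eq, Set.ncard_eq_toFinset_card']
      exact hw
    exact huv ((Set.ncard_le_one (Set.toFinite _)).1 hp u (hmem u hu) v (hmem v hv))
  rw [isAcyclic_iff_free_cycleGraph] at hac
  push Not at hac
  obtain ⟨k, hk, hfree⟩ := hac
  obtain ⟨f⟩ := hfree
  -- In the form `m + 3`, `ZMod` unfolds to the `Fin` on which `cycleGraph` lives.
  obtain ⟨m, rfl⟩ := Nat.exists_eq_add_of_le' hk
  refine ⟨m + 3, f.toHom, hk, f.injective', fun i => f.toHom.map_adj ?_⟩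
  exact (cycleGraph_adj (n := m + 1)).2
    (Or.inr (add_sub_cancel_left (i : ZMod (m + 3)) (1 : ZMod (m + 3))))

/-! ### The lollipop belongs to the class -/

theorem lollipop_three_adj {n : ℕ} {i j : Fin n} :
    (lollipop n 3).Adj i j ↔ LollipopRel i.val j.val := by
  unfold lollipop LollipopRel
  rw [SimpleGraph.fromRel_adj, Ne, Fin.ext_iff]
  omega

theorem lollipop_three_memPendantClass {n : ℕ} (hn : 4 ≤ n) :
    MemPendantClass (lollipop n 3) n 1 := by
  refine ⟨inferInstance, by simp, ?_, ?_⟩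
  · have h0 : ∀ i (hi : i < n), (lollipop n 3).Reachable ⟨0, by omega⟩ ⟨i, hi⟩ := by
      intro i
      induction i with
      | zero => exact fun _ => Reachable.refl _
      | succ i ih =>
        intro hi
        refine (ih (by omega)).trans (Adj.reachable ?_)
        rw [lollipop_three_adj]
        exact Or.inl (Or.inl rfl)
    exact Connected.mk (fun x y => (h0 x.1 x.2).symm.trans (h0 y.1 y.2))
      (nonempty := ⟨⟨0, by omega⟩⟩)
  · have : pendantVertices (lollipop n 3) = {⟨n - 1, by omega⟩} := by
      ext v
      rw [pendantVertices, Set.mem_ofPred_eq, Set.mem_singleton_iff]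
      constructor
      · intro h
        obtain ⟨a, ha⟩ := Set.ncard_eq_one.1 h
        have huniq : ∀ i (hi : i < n), LollipopRel v.val i → i = a.val := by
          intro i hi hr
          have : (⟨i, hi⟩ : Fin n) ∈ (lollipop n 3).neighborSet v := by
            rw [mem_neighborSet, lollipop_three_adj]
            exact hr
          rw [ha, Set.mem_singleton_iff] at this
          rw [← this]
        rw [Fin.ext_iff]
        by_contra hv
        dsimp only at hv
        have hvn := v.2
        unfold LollipopRel at huniq
        -- A vertex other than `n - 1` has the neighbour `v + 1` and a second one: `2` if `v = 0`,
        -- else `v - 1`.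
        have h1 := huniq (v.val + 1) (by omega) (by omega)
        rcases Nat.eq_zero_or_pos v.val with h0 | h0
        · have h2 := huniq 2 (by omega) (by omega)
          omega
        · have h2 := huniq (v.val - 1) (by omega) (by omega)
          omega
      · rintro rfl
        rw [Set.ncard_eq_one]
        refine ⟨⟨n - 2, by omega⟩, ?_⟩
        ext w
        have := w.2
        rw [mem_neighborSet, lollipop_three_adj, Set.mem_singleton_iff, Fin.ext_iff]
        unfold LollipopRel
        dsimp only
        omega
    rw [this, Set.ncard_singleton]

/-! ### Upper bound for the lollipop -/

section UpperBound

variable {n : ℕ} {H H' : (lollipop n 3).Subgraph}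

/-- A connected subgraph of the lollipop contains every tail edge between two of its vertices. -/
theorem adj_of_tail (hH : H.Connected) {x a b y : Fin n} (hx : x ∈ H.verts) (hy : y ∈ H.verts)
    (hxa : x ≤ a) (ha : 2 ≤ a.val) (hab : a.val + 1 = b.val) (hby : b ≤ y) : H.Adj a b := by
  rw [Fin.le_def] at hxa hby
  obtain ⟨p, q, hp, hq, hpq⟩ := exists_adj_leaving hH (S := {z | z.val ≤ a.val}) hx hxa hy
    (by rw [Set.mem_ofPred_eq]; omega)
  have hr := lollipop_three_adj.1 hpq.adj_sub
  rw [Set.mem_ofPred_eq] at hp hq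
  unfold LollipopRel at hr
  have h1 : p = a := Fin.ext (by omega)
  have h2 : q = b := Fin.ext (by omega)
  rwa [h1, h2] at hpq

theorem mem_of_between (hH : H.Connected) {x a y : Fin n} (hx : x ∈ H.verts) (hy : y ∈ H.verts)
    (hxa : x ≤ a) (ha : 2 ≤ a.val) (hay : a ≤ y) : a ∈ H.verts := by
  rcases hay.eq_or_lt with rfl | h
  · exact hy
  · rw [Fin.lt_def] at h
    exact (adj_of_tail hH (b := ⟨a.val + 1, by omega⟩) hx hy hxa ha rfl
      (by rw [Fin.le_def]; exact h)).fst_mem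

theorem le_of_triangle_agree (hH' : H'.Connected) (hv : H.verts = H'.verts)
    (ht : ∀ x y : Fin n, x.val < y.val → y.val ≤ 2 → H.Adj x y → H'.Adj x y) : H ≤ H' := by
  have key : ∀ x y : Fin n, x.val < y.val → H.Adj x y → H'.Adj x y := by
    intro x y hlt hxy
    by_cases hy : y.val ≤ 2
    · exact ht x y hlt hy hxy
    · have hr := lollipop_three_adj.1 hxy.adj_sub
      unfold LollipopRel at hr
      exact adj_of_tail hH' (hv ▸ hxy.fst_mem) (hv ▸ hxy.snd_mem) le_rfl (by omega) (by omega)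
        le_rfl
  refine ⟨hv.le, fun x y hxy => ?_⟩
  rcases lt_trichotomy x.val y.val with h | h | h
  · exact key x y h hxy
  · exact absurd (Fin.ext h) hxy.ne
  · exact (key y x h hxy.symm).symm

/-- Tail edges are bridges, so the vertex set of a connected subgraph decides them; only triangle
edges remain free. -/
theorem eq_of_triangle_agree (hH : H.Connected) (hH' : H'.Connected) (hv : H.verts = H'.verts)
    (ht : ∀ x y : Fin n, x.val < y.val → y.val ≤ 2 → (H.Adj x y ↔ H'.Adj x y)) : H = H' :=
  le_antisymm (le_of_triangle_agree hH' hv fun x y h1 h2 => (ht x y h1 h2).1)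
    (le_of_triangle_agree hH hv.symm fun x y h1 h2 => (ht x y h1 h2).2)

theorem ncard_connected_verts_lt_two_le (hn : 4 ≤ n) :
    {H : (lollipop n 3).Subgraph | H.Connected ∧ ∀ z ∈ H.verts, z.val < 2}.ncard ≤ 3 := by
  classical
  let a : Fin n := ⟨0, by omega⟩
  let b : Fin n := ⟨1, by omega⟩
  let T : Finset (Set (Fin n)) := {{a}, {b}, {a, b}}
  have hT : T.card ≤ 3 := Finset.card_le_three
  have hab : ∀ z : Fin n, z.val < 2 → z = a ∨ z = b := fun z hz => by
    rw [Fin.ext_iff, Fin.ext_iff]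
    simp only [a, b]
    omega
  rw [← Set.ncard_coe_finset] at hT
  refine le_trans (Set.ncard_le_ncard_of_injOn Subgraph.verts ?_ ?_ (Set.toFinite _)) hT
  · rintro H ⟨hH, hz⟩
    have hsub : H.verts ⊆ {a, b} := fun z hz' => hab z (hz z hz')
    rw [Set.subset_pair_iff_eq] at hsub
    have hne := hH.nonempty.ne_empty
    simp only [T, Finset.coe_insert, Finset.coe_singleton, Set.mem_insert_iff,
      Set.mem_singleton_iff]
    tauto
  · have key : ∀ {H : (lollipop n 3).Subgraph}, H.Connected → (∀ z ∈ H.verts, z.val < 2) →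
        ∀ x y : Fin n, x.val < y.val → (H.Adj x y ↔ x ∈ H.verts ∧ y ∈ H.verts) := by
      intro H hH hz x y hxy
      refine ⟨fun h => ⟨h.fst_mem, h.snd_mem⟩, fun h => ?_⟩
      obtain ⟨p, q, hp, hq, hpq⟩ := exists_adj_leaving hH (S := {z | z.val ≤ x.val}) h.1 (le_refl x.val)
        h.2 (by rw [Set.mem_ofPred_eq]; omega)
      have h1 := hz p hpq.fst_mem
      have h2 := hz q hpq.snd_mem
      have h3 := hz y h.2
      rw [Set.mem_ofPred_eq] at hp hq
      have e1 : p = x := Fin.ext (by omega)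
      have e2 : q = y := Fin.ext (by omega)
      rwa [e1, e2] at hpq
    rintro H ⟨hH, hz⟩ H' ⟨hH', hz'⟩ e
    refine eq_of_triangle_agree hH hH' e fun x y hxy _ => ?_
    rw [key hH hz x y hxy, key hH' hz' x y hxy, e]

/-- These subgraphs are the subpaths of a path on `n - 3` vertices, each coded by its two ends. -/
theorem ncard_connected_tail_le (hn : 4 ≤ n) :
    {H : (lollipop n 3).Subgraph | H.Connected ∧ ∀ z ∈ H.verts, 3 ≤ z.val}.ncard * 2 ≤
      (n - 3) * (n - 2) := by
  classical
  let T : Finset (Set (Fin n)) := ((Finset.range (n - 3)).sigma fun j => Finset.range (j + 1)).image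
    fun q => {z | 3 + q.2 ≤ z.val ∧ z.val ≤ 3 + q.1}
  have hT : T.card * 2 ≤ (n - 3) * (n - 2) := by
    have h1 : T.card ≤ _ := Finset.card_image_le
    rw [Finset.card_sigma] at h1
    simp only [Finset.card_range] at h1
    have h2 := Finset.sum_range_id_mul_two (n - 3 + 1)
    rw [Finset.sum_range_succ'] at h2
    simp only [add_zero, Nat.add_sub_cancel] at h2
    have h3 : n - 3 + 1 = n - 2 := by omega
    rw [h3, mul_comm (n - 2)] at h2
    omega
  refine le_trans (Nat.mul_le_mul_right 2 ?_) hT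
  rw [← Set.ncard_coe_finset]
  refine Set.ncard_le_ncard_of_injOn Subgraph.verts ?_ ?_ (Set.toFinite _)
  · rintro H ⟨hH, hz⟩
    obtain ⟨a, ha, hmin⟩ := Set.exists_min_image H.verts id (Set.toFinite _) hH.nonempty
    obtain ⟨b, hb, hmax⟩ := Set.exists_max_image H.verts id (Set.toFinite _) hH.nonempty
    have ha3 := hz a ha
    have hab : a.val ≤ b.val := hmin b hb
    have hbn := b.2
    simp only [T, Finset.coe_image, Finset.coe_sigma, Set.mem_image, Set.mem_sigma_iff,
      Finset.mem_coe, Finset.mem_range]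
    refine ⟨⟨b.val - 3, a.val - 3⟩, ⟨by dsimp only; omega, by dsimp only; omega⟩, ?_⟩
    ext z
    rw [Set.mem_ofPred_eq]
    dsimp only
    constructor
    · rintro ⟨h1, h2⟩
      exact mem_of_between hH ha hb (by rw [Fin.le_def]; omega) (by omega)
        (by rw [Fin.le_def]; omega)
    · intro h
      have h1 : a.val ≤ z.val := hmin z h
      have h2 : z.val ≤ b.val := hmax z h
      omega
  · rintro H ⟨hH, hz⟩ H' ⟨hH', hz'⟩ e
    refine eq_of_triangle_agree hH hH' e fun x y hxy hy => ?_
    constructor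
    · intro h
      have := hz y h.snd_mem
      omega
    · intro h
      have := hz' y h.snd_mem
      omega

/-- Such a subgraph is coded by its triangle edges and its extent along the tail. Of the eight edge
sets, the edge `ab` alone is impossible, as it would be cut off from the root `r`; the tail can stop
at `n - 2` places. -/
theorem ncard_connected_root_le (hn : 4 ≤ n) :
    {H : (lollipop n 3).Subgraph | H.Connected ∧ (⟨2, by omega⟩ : Fin n) ∈ H.verts}.ncard ≤
      7 * (n - 2) := by
  classical
  let a : Fin n := ⟨0, by omega⟩
  let b : Fin n := ⟨1, by omega⟩
  let r : Fin n := ⟨2, by omega⟩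
  let T : Finset (Set (Fin n)) := (Finset.range (n - 2)).image fun j =>
    {z | 2 ≤ z.val ∧ z.val ≤ 2 + j}
  let S : Finset ((Bool × Bool × Bool) × Set (Fin n)) :=
    (Finset.univ.erase (true, false, false)) ×ˢ T
  have hS : S.card ≤ 7 * (n - 2) := by
    rw [Finset.card_product, Finset.card_erase_of_mem (Finset.mem_univ _)]
    exact Nat.mul_le_mul (by simp) (Finset.card_image_le.trans (by simp))
  refine le_trans ?_ hS
  rw [← Set.ncard_coe_finset]
  let f : (lollipop n 3).Subgraph → (Bool × Bool × Bool) × Set (Fin n) := fun H =>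
    ((decide (H.Adj a b), decide (H.Adj a r), decide (H.Adj b r)), {z ∈ H.verts | 2 ≤ z.val})
  have hsmall : ∀ x y : Fin n, x.val < y.val → y.val ≤ 2 →
      (x = a ∧ y = b) ∨ (x = a ∧ y = r) ∨ (x = b ∧ y = r) := fun x y h1 h2 => by
    simp only [a, b, r, Fin.ext_iff]
    omega
  refine Set.ncard_le_ncard_of_injOn f ?_ ?_ (Set.toFinite _)
  · rintro H ⟨hH, hr⟩
    rw [Finset.mem_coe, Finset.mem_product]
    constructor
    · rw [Finset.mem_erase]
      refine ⟨fun e => ?_, Finset.mem_univ _⟩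
      simp only [f, Prod.mk.injEq, decide_eq_true_eq, decide_eq_false_iff_not] at e
      obtain ⟨e1, e2, e3⟩ := e
      obtain ⟨p, q, hp, hq, hpq⟩ := exists_adj_leaving hH (S := {z | z.val ≤ 1}) e1.fst_mem
        (by simp [a]) hr (by simp)
      rw [Set.mem_ofPred_eq] at hp hq
      have h := lollipop_three_adj.1 hpq.adj_sub
      unfold LollipopRel at h
      rcases hsmall p q (by omega) (by omega) with ⟨rfl, rfl⟩ | ⟨rfl, rfl⟩ | ⟨rfl, rfl⟩
      · simp [b] at hq
      · exact e2 hpq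
      · exact e3 hpq
    · obtain ⟨m, hm, hmax⟩ := Set.exists_max_image H.verts id (Set.toFinite _) hH.nonempty
      have h2m : 2 ≤ m.val := hmax r hr
      have hmn := m.2
      refine Finset.mem_image.2 ⟨m.val - 2, by rw [Finset.mem_range]; omega, ?_⟩
      ext z
      simp only [f, Set.mem_ofPred_eq]
      constructor
      · rintro ⟨h1, h2⟩
        exact ⟨mem_of_between hH hr hm (by rw [Fin.le_def]; exact h1) h1
          (by rw [Fin.le_def]; omega), h1⟩
      · rintro ⟨h1, h2⟩
        have h3 : z.val ≤ m.val := hmax z h1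
        omega
  -- The code omits the vertices `0` and `1`; they are recovered as ends of triangle edges.
  · have key : ∀ {H : (lollipop n 3).Subgraph}, H.Connected → r ∈ H.verts → ∀ z : Fin n,
        z.val < 2 → (z ∈ H.verts ↔ ∃ w : Fin n, w.val ≤ 2 ∧ H.Adj z w) := by
      intro H hH hr z hz
      refine ⟨fun h => ?_, fun ⟨w, _, h⟩ => h.fst_mem⟩
      obtain ⟨p, q, rfl, -, hpq⟩ := exists_adj_leaving hH (S := {z}) h rfl hr (by
        rintro rfl
        simp [r] at hz)
      have h := lollipop_three_adj.1 hpq.adj_sub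
      unfold LollipopRel at h
      exact ⟨q, by omega, hpq⟩
    rintro H ⟨hH, hr⟩ H' ⟨hH', hr'⟩ e
    simp only [f, Prod.mk.injEq, decide_eq_decide] at e
    obtain ⟨⟨e1, e2, e3⟩, e4⟩ := e
    have ht : ∀ x y : Fin n, x.val < y.val → y.val ≤ 2 → (H.Adj x y ↔ H'.Adj x y) := by
      intro x y h1 h2
      rcases hsmall x y h1 h2 with ⟨rfl, rfl⟩ | ⟨rfl, rfl⟩ | ⟨rfl, rfl⟩ <;> assumption
    refine eq_of_triangle_agree hH hH' ?_ ht
    ext z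
    rcases Nat.lt_or_ge z.val 2 with hz | hz
    · rw [key hH hr z hz, key hH' hr' z hz]
      refine exists_congr fun w => and_congr_right fun hw => ?_
      rcases lt_trichotomy z.val w.val with h | h | h
      · exact ht z w h hw
      · rw [Fin.ext h]
        exact ⟨fun h => absurd rfl h.ne, fun h => absurd rfl h.ne⟩
      · rw [H.adj_comm, H'.adj_comm]
        exact ht w z h (by omega)
    · have := Set.ext_iff.1 e4 z
      simp only [Set.mem_ofPred_eq, hz, and_true] at this
      exact this

/-- A connected subgraph contains the root, lies in `{0, 1}`, or lies in the tail beyond the root.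
The total is at most `7 * (n - 2) + 3 + (n - 3) * (n - 2) / 2`. -/
theorem coreIndex_lollipop_three_le (hn : 4 ≤ n) :
    2 * coreIndex (lollipop n 3) + 16 ≤ n ^ 2 + 9 * n := by
  have hsub : {H : (lollipop n 3).Subgraph | H.Connected} ⊆
      ({H | H.Connected ∧ ∀ z ∈ H.verts, z.val < 2} ∪
        {H | H.Connected ∧ ∀ z ∈ H.verts, 3 ≤ z.val}) ∪
        {H | H.Connected ∧ (⟨2, by omega⟩ : Fin n) ∈ H.verts} := by
    intro H hH
    by_cases hr : (⟨2, by omega⟩ : Fin n) ∈ H.verts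
    · exact Or.inr ⟨hH, hr⟩
    left
    have hne : ∀ z ∈ H.verts, z.val ≠ 2 := fun z hz e => by
      have : z = ⟨2, by omega⟩ := Fin.ext e
      exact hr (this ▸ hz)
    by_cases hs : ∀ z ∈ H.verts, z.val < 2
    · exact Or.inl ⟨hH, hs⟩
    · push Not at hs
      obtain ⟨y, hy, hy2⟩ := hs
      refine Or.inr ⟨hH, fun z hz => ?_⟩
      by_contra hz3
      have := hne z hz
      exact hr (mem_of_between hH hz hy (by rw [Fin.le_def]; dsimp only; omega) le_rfl
        (by rw [Fin.le_def]; exact hy2))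
  have h1 := Set.ncard_le_ncard hsub (Set.toFinite _)
  have h2 := Set.ncard_union_le ({H : (lollipop n 3).Subgraph | H.Connected ∧ ∀ z ∈ H.verts,
    z.val < 2} ∪ {H | H.Connected ∧ ∀ z ∈ H.verts, 3 ≤ z.val})
    {H | H.Connected ∧ (⟨2, by omega⟩ : Fin n) ∈ H.verts}
  have h3 := Set.ncard_union_le {H : (lollipop n 3).Subgraph | H.Connected ∧ ∀ z ∈ H.verts,
    z.val < 2} {H | H.Connected ∧ ∀ z ∈ H.verts, 3 ≤ z.val}
  have h4 := ncard_connected_verts_lt_two_le hn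
  have h5 := ncard_connected_tail_le hn
  have h6 := ncard_connected_root_le hn
  unfold coreIndex
  obtain ⟨m, rfl⟩ := Nat.exists_eq_add_of_le' hn
  have e1 : m + 4 - 3 = m + 1 := by omega
  have e2 : m + 4 - 2 = m + 2 := by omega
  rw [e1, e2] at h5
  rw [e2] at h6
  nlinarith

end UpperBound

/-! ### Invariance under isomorphism -/

theorem connected_map_of_connected {W : Type*} {G' : SimpleGraph W} (φ : G →g G')
    {H : G.Subgraph} (hH : H.Connected) : (H.map φ).Connected := by
  rw [Subgraph.connected_iff'] at hH ⊢
  let f : H.coe →g (H.map φ).coe :=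
    ⟨fun x => ⟨φ x.1, x.1, x.2, rfl⟩, fun {x y} hxy => ⟨x.1, y.1, hxy, rfl, rfl⟩⟩
  refine hH.map f ?_
  rintro ⟨_, x, hx, rfl⟩
  exact ⟨⟨x, hx⟩, rfl⟩

theorem coreIndex_le_of_iso {W : Type*} [Finite W] {G' : SimpleGraph W} (φ : G ≃g G') :
    coreIndex G ≤ coreIndex G' := by
  refine Set.ncard_le_ncard_of_injOn (fun H => H.map φ.toHom)
    (fun H hH => connected_map_of_connected φ.toHom hH) ?_ (Set.toFinite _)
  intro H _ H' _ e
  have : ∀ D : G.Subgraph, (D.map φ.toHom).map φ.symm.toHom = D := fun D => by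
    rw [← Subgraph.map_comp]
    convert Subgraph.map_id D
    ext x
    simp
  dsimp only at e
  rw [← this H, ← this H', e]

theorem nonempty_iso_of_isLollipop_top {n : ℕ} {v : V} (h : IsLollipop (⊤ : G.Subgraph) n v) :
    Nonempty (G ≃g lollipop n 3) := by
  obtain ⟨-, p, hinj, hverts, -, hadj⟩ := h
  have hbij : Function.Bijective fun i : Fin n => p i.val := by
    refine ⟨fun i j e => Fin.ext (hinj i.2 j.2 e), fun x => ?_⟩
    have hx : x ∈ (⊤ : G.Subgraph).verts := trivial
    rw [hverts] at hx
    obtain ⟨i, hi, rfl⟩ := hx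
    exact ⟨⟨i, hi⟩, rfl⟩
  refine ⟨Iso.symm ⟨Equiv.ofBijective _ hbij, fun {i j} => ?_⟩⟩
  rw [lollipop_three_adj, ← hadj i.val i.2 j.val j.2]
  rfl

/-! ### Removing the pendant vertex and conclusion -/

/-- A pendant vertex lies on no cycle. -/
theorem notMem_cycle_of_pendant {k : ℕ} {c : ZMod k → V} (hk : 3 ≤ k)
    (hinj : Function.Injective c) (hc : ∀ i, G.Adj (c i) (c (i + 1))) {v : V}
    (hv : v ∈ pendantVertices G) (i : ZMod k) : c i ≠ v := by
  rintro rfl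
  obtain ⟨a, ha⟩ := Set.ncard_eq_one.1 hv
  have h1 : c (i + 1) ∈ G.neighborSet (c i) := hc i
  have h2 : c (i - 1) ∈ G.neighborSet (c i) := by
    have := hc (i - 1)
    rw [sub_add_cancel] at this
    exact this.symm
  rw [ha, Set.mem_singleton_iff] at h1 h2
  have h3 := hinj (h1.trans h2.symm)
  have h4 : ((2 : ℕ) : ZMod k) = 0 := by
    push_cast
    linear_combination h3
  rw [ZMod.natCast_eq_zero_iff] at h4
  exact absurd (Nat.le_of_dvd (by norm_num) h4) (by omega)

/-- Deleting a pendant vertex from a connected graph leaves a connected graph. -/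
theorem connected_deleteVerts_pendant (hG : G.Connected) {v : V} (hv : v ∈ pendantVertices G) :
    ((⊤ : G.Subgraph).induce {v}ᶜ).Connected := by
  have : Finite (G.neighborSet v) := Set.finite_of_ncard_ne_zero (by rw [hv]; norm_num)
  have := Fintype.ofFinite (G.neighborSet v)
  rw [← connected_induce_iff]
  refine hG.induce_compl_singleton_of_degree_eq_one ?_
  rw [pendantVertices, Set.mem_ofPred_eq, Set.ncard_eq_toFinset_card'] at hv
  exact hv

/-- A connected graph on `n` vertices with exactly one pendant vertex is the lollipop or has more
connected subgraphs than the lollipop. -/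
theorem MemPendantClass.lt_or_iso {n : ℕ} (hn : 4 ≤ n) (hG : MemPendantClass G n 1) :
    coreIndex (lollipop n 3) < coreIndex G ∨ Nonempty (G ≃g lollipop n 3) := by
  have := hG.finite
  have : Nontrivial V := by
    rw [← Finite.one_lt_card_iff_nontrivial, hG.card_eq]
    omega
  obtain ⟨k, c, hk, hinj, hc⟩ := exists_cycle hG.connected hG.pendant.le
  have : NeZero k := ⟨by omega⟩
  obtain ⟨v, hv⟩ := Set.ncard_eq_one.1 hG.pendant
  have hv : v ∈ pendantVertices G := by rw [hv]; rfl
  have hcv := notMem_cycle_of_pendant hk hinj hc hv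
  set K : G.Subgraph := (⊤ : G.Subgraph).induce {v}ᶜ with hK
  have hcK : arc hc 0 k ≤ K := by
    refine ⟨?_, ?_⟩
    · rintro _ ⟨m, -, rfl⟩
      exact hcv m
    · intro x y h
      refine ⟨?_, ?_, h.adj_sub⟩
      · obtain ⟨m, -, rfl⟩ := h.fst_mem
        exact hcv m
      · obtain ⟨m, -, rfl⟩ := h.snd_mem
        exact hcv m
  have hbK := cyclicBounds_of_cycle_le hc hk hinj (connected_deleteVerts_pendant hG.connected hv)
    hcK
  have hbT := cyclicBounds_of_cycle_le hc hk hinj (K := (⊤ : G.Subgraph))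
    (Subgraph.connected_iff'.2 (Subgraph.topIso.connected_iff.2 hG.connected)) le_top
  have hcardT : (⊤ : G.Subgraph).verts.ncard = n := by
    rw [Subgraph.verts_top, Set.ncard_univ, hG.card_eq]
  have hcardK : K.verts.ncard + 1 = n := by
    rw [hK, Subgraph.induce_verts, ← hG.card_eq, ← Set.ncard_add_ncard_compl {v},
      Set.ncard_singleton, add_comm]
  have h6 := hbT.add_six_le v trivial
  rw [hcardT] at h6
  rcases h6 with h6 | hl
  · left
    have h1 := hbK.quadratic_le
    have h2 : connCount K + connCountAt ⊤ v ≤ connCount (⊤ : G.Subgraph) :=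
      connCount_add_connCountAt_le le_top (by simp [hK])
    have h3 := coreIndex_lollipop_three_le hn
    rw [coreIndex_eq_connCount_top (G := G)]
    subst hcardK
    -- The quadratic bound at `n - 1` plus `n + 6` gives `2 * coreIndex G ≥ n ^ 2 + 9 * n - 14`,
    -- beating the lollipop's `- 16`.
    nlinarith
  · exact Or.inr (nonempty_iso_of_isLollipop_top hl)

end CoreIndex

theorem theorem5p6 (n : ℕ) (hn : 4 ≤ n) :
    CoreIndex.MemPendantClass (CoreIndex.lollipop n 3) n 1 ∧
      ∀ (V : Type*) (G : SimpleGraph V), CoreIndex.MemPendantClass G n 1 →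
        CoreIndex.coreIndex (CoreIndex.lollipop n 3) ≤ CoreIndex.coreIndex G ∧
        (CoreIndex.coreIndex G = CoreIndex.coreIndex (CoreIndex.lollipop n 3) ↔
          Nonempty (G ≃g CoreIndex.lollipop n 3)) := by
  refine ⟨CoreIndex.lollipop_three_memPendantClass hn, fun V G hG => ?_⟩
  have hfin := hG.finite
  have hiso : Nonempty (G ≃g CoreIndex.lollipop n 3) →
      CoreIndex.coreIndex G = CoreIndex.coreIndex (CoreIndex.lollipop n 3) := fun ⟨φ⟩ =>
    le_antisymm (CoreIndex.coreIndex_le_of_iso φ) (CoreIndex.coreIndex_le_of_iso φ.symm)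
  rcases hG.lt_or_iso hn with h | h
  · exact ⟨h.le, fun e => absurd e h.ne', hiso⟩
  · exact ⟨(hiso h).ge, fun _ => h, hiso⟩
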